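/- Let $X$ be a quasi-projective variety over $\overline{\mathbb{Q}}$ (a Zariski locally closed subset of some $\mathbb{P}^N(\overline{\mathbb{Q}})$, not necessarily irreducible), let $\Phi\colon X\dashrightarrow X$ be a rational self-map, and let $f\colon X\dashrightarrow\mathbb{P}^1$ be a non-constant rational function, all defined over $\overline{\mathbb{Q}}$. Let $h$ denote the absolute logarithmic Weil height on $\mathbb{P}^1(\overline{\mathbb{Q}})$, and let $I_\Phi$ and $I_f$ denote the indeterminacy loci of $\Phi$ and $f$. Let $x\in X(\overline{\mathbb{Q}})$ be a point such that, for every $n\ge 0$, the iterate $\Phi^n(x)$ lies neither in $I_\Phi$ nor in $I_f$, and let $\mathcal{O}_\Phi(x)=\{\Phi^n(x) : n\ge 0\}$ be its forward orbit. Then either $f(\mathcal{O}_\Phi(x))$ is a finite set, or $$\limsup_{n\to\infty}\frac{h(f(\Phi^n(x)))}{\log n}>0,$$ where the limsup may be $+\infty$. -/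

import Mathlib

namespace HeightGap

/-- The field `Q̄` of algebraic numbers. -/
abbrev Qbar : Type := AlgebraicClosure ℚ

/-- Projective `n`-space over `Q̄` (its set of `Q̄`-points). -/
def ProjSpace (n : ℕ) : Type := Projectivization Qbar (Fin (n + 1) → Qbar)

/-- Homogeneous coordinates of a point of projective space. -/
noncomputable def ProjSpace.coords {n : ℕ} (P : ProjSpace n) : Fin (n + 1) → Qbar :=
  Projectivization.rep P

/-- The point of projective space with given homogeneous coordinates, not all zero. -/
noncomputable def ProjSpace.mk {n : ℕ} (v : Fin (n + 1) → Qbar) (hv : v ≠ 0) : ProjSpace n :=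
  Projectivization.mk Qbar v hv

/-- The common zeros in projective space of a set of polynomials (used for homogeneous ones, for
which the choice of the homogeneous coordinates of a point does not matter). -/
def zeroLocus {n : ℕ} (S : Set (MvPolynomial (Fin (n + 1)) Qbar)) : Set (ProjSpace n) :=
  {P | ∀ F ∈ S, MvPolynomial.eval P.coords F = 0}

/-- A subset of projective space is algebraic if it is the zero locus of a set of homogeneous
polynomials. -/
def IsAlgebraicSet {n : ℕ} (Z : Set (ProjSpace n)) : Prop :=
  ∃ S : Set (MvPolynomial (Fin (n + 1)) Qbar), (∀ F ∈ S, ∃ d, F.IsHomogeneous d) ∧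
    zeroLocus S = Z

/-- The Zariski topology on projective space: the closed sets are the algebraic sets. -/
instance zariskiTopology (n : ℕ) : TopologicalSpace (ProjSpace n) :=
  TopologicalSpace.ofClosed {Z | IsAlgebraicSet Z}
    (by
      refine ⟨{1}, ?_, ?_⟩
      · rintro F rfl
        exact ⟨0, MvPolynomial.isHomogeneous_one _ _⟩
      · ext P
        simp [zeroLocus])
    (by
      intro A hA
      refine ⟨{F | (∃ d, F.IsHomogeneous d) ∧ ∃ Z ∈ A, ∀ P ∈ Z, MvPolynomial.eval P.coords F = 0},
        fun F hF => hF.1, ?_⟩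
      ext P
      constructor
      · intro hP Z hZ
        obtain ⟨S, hS, rfl⟩ := hA hZ
        exact fun F hF => hP F ⟨hS F hF, _, hZ, fun Q hQ => hQ F hF⟩
      · rintro hP F ⟨_, Z, hZ, hF⟩
        exact hF P (hP Z hZ))
    (by
      rintro _ ⟨S, hS, rfl⟩ _ ⟨T, hT, rfl⟩
      refine ⟨{H | ∃ F ∈ S, ∃ G ∈ T, H = F * G}, ?_, ?_⟩
      · rintro _ ⟨F, hF, G, hG, rfl⟩
        obtain ⟨d, hd⟩ := hS F hF
        obtain ⟨e, he⟩ := hT G hG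
        exact ⟨d + e, hd.mul he⟩
      · ext P
        constructor
        · intro hP
          by_contra hcon
          simp only [Set.mem_union, not_or, zeroLocus, Set.mem_ofPred_eq, not_forall] at hcon
          obtain ⟨⟨F, hF, hF0⟩, G, hG, hG0⟩ := hcon
          have := hP (F * G) ⟨F, hF, G, hG, rfl⟩
          rw [map_mul] at this
          exact (mul_ne_zero hF0 hG0) this
        · rintro (hP | hP) _ ⟨F, hF, G, hG, rfl⟩
          · rw [map_mul, hP F hF, zero_mul]
          · rw [map_mul, hP G hG, mul_zero])

theorem isClosed_iff_isAlgebraicSet {n : ℕ} (Z : Set (ProjSpace n)) :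
    IsClosed Z ↔ IsAlgebraicSet Z := by
  rw [← isOpen_compl_iff]
  change IsAlgebraicSet Zᶜᶜ ↔ _
  rw [compl_compl]

theorem isOpen_eval_ne_zero {n : ℕ} {d : ℕ} (F : MvPolynomial (Fin (n + 1)) Qbar)
    (hF : F.IsHomogeneous d) : IsOpen {P : ProjSpace n | MvPolynomial.eval P.coords F ≠ 0} := by
  rw [← isClosed_compl_iff]
  refine (isClosed_iff_isAlgebraicSet _).2 ⟨{F}, ?_, ?_⟩
  · rintro _ rfl
    exact ⟨d, hF⟩
  · ext P
    simp [zeroLocus]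

/-- The values at the homogeneous coordinates of `P` of a tuple of polynomials. -/
noncomputable def evalTuple {n m : ℕ} (F : Fin (m + 1) → MvPolynomial (Fin (n + 1)) Qbar)
    (P : ProjSpace n) : Fin (m + 1) → Qbar :=
  fun i => MvPolynomial.eval P.coords (F i)

/-- A map from a subset `U` of `X ⊆ ℙⁿ` to `Y ⊆ ℙᵐ` is regular if near every point of `U` it is
given by `P ↦ [F₀(P) : ⋯ : Fₘ(P)]` for homogeneous polynomials `F₀, …, Fₘ` of one common degree
that have no common zero there. -/
def IsRegularMap {n m : ℕ} {X : Set (ProjSpace n)} {Y : Set (ProjSpace m)} (U : Set X)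
    (g : U → Y) : Prop :=
  ∀ P : U, ∃ V : Set X, IsOpen V ∧ (P : X) ∈ V ∧
    ∃ (d : ℕ) (F : Fin (m + 1) → MvPolynomial (Fin (n + 1)) Qbar), (∀ i, (F i).IsHomogeneous d) ∧
      ∀ Q : U, (Q : X) ∈ V → ∃ h : evalTuple F (Q : X).1 ≠ 0,
        (g Q : ProjSpace m) = ProjSpace.mk (evalTuple F (Q : X).1) h

/-- A regular map to `Y` defined on a dense (Zariski) open subset of `X`. -/
structure PartialMap {n m : ℕ} (X : Set (ProjSpace n)) (Y : Set (ProjSpace m)) where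
  /-- The open set on which the map is given. -/
  domain : Set X
  isOpen_domain : IsOpen domain
  dense_domain : Dense domain
  /-- The map. -/
  toFun : domain → Y
  isRegular : IsRegularMap domain toFun

variable {n m : ℕ} {X : Set (ProjSpace n)} {Y : Set (ProjSpace m)}

/-- Two partially defined regular maps are equivalent if they agree on a dense open set. -/
def PartialMap.Equivalent (g h : PartialMap X Y) : Prop :=
  ∃ W : Set X, IsOpen W ∧ Dense W ∧ ∃ (hg : W ⊆ g.domain) (hh : W ⊆ h.domain),
    ∀ (P : X) (hP : P ∈ W), g.toFun ⟨P, hg hP⟩ = h.toFun ⟨P, hh hP⟩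

instance PartialMap.setoid (X : Set (ProjSpace n)) (Y : Set (ProjSpace m)) :
    Setoid (PartialMap X Y) where
  r := PartialMap.Equivalent
  iseqv :=
    { refl := fun g => ⟨g.domain, g.isOpen_domain, g.dense_domain, subset_rfl, subset_rfl,
        fun _ _ => rfl⟩
      symm := fun ⟨W, hW, hd, h₁, h₂, h⟩ => ⟨W, hW, hd, h₂, h₁, fun P hP => (h P hP).symm⟩
      trans := fun ⟨W, hW, hd, h₁, _, h⟩ ⟨W', hW', hd', _, h₂', h'⟩ =>
        ⟨W ∩ W', hW.inter hW', hd.inter_of_isOpen_left hd' hW, fun _ hP => h₁ hP.1,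
          fun _ hP => h₂' hP.2, fun P hP => (h P hP.1).trans (h' P hP.2)⟩ }

/-- A rational map from `X` to `Y`: an equivalence class of regular maps to `Y` given on dense
open subsets of `X`. -/
def RationalMap {n m : ℕ} (X : Set (ProjSpace n)) (Y : Set (ProjSpace m)) : Type :=
  Quotient (PartialMap.setoid X Y)

/-- The rational map represented by a partially defined regular map. -/
def PartialMap.toRationalMap (g : PartialMap X Y) : RationalMap X Y := Quotient.mk _ g

/-- Two equivalent partially defined regular maps agree wherever both are defined. -/
theorem PartialMap.Equivalent.eq {g h : PartialMap X Y} (H : g.Equivalent h) (P : X)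
    (hPg : P ∈ g.domain) (hPh : P ∈ h.domain) : g.toFun ⟨P, hPg⟩ = h.toFun ⟨P, hPh⟩ := by
  obtain ⟨W, -, hWd, hWg, hWh, hW⟩ := H
  obtain ⟨V₁, hV₁, hP₁, d, F, hF, hgF⟩ := g.isRegular ⟨P, hPg⟩
  obtain ⟨V₂, hV₂, hP₂, e, G, hG, hhG⟩ := h.isRegular ⟨P, hPh⟩
  obtain ⟨hF0, hgP⟩ := hgF ⟨P, hPg⟩ hP₁
  obtain ⟨hG0, hhP⟩ := hhG ⟨P, hPh⟩ hP₂
  have key : ∀ i j, evalTuple F P.1 i * evalTuple G P.1 j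
      = evalTuple F P.1 j * evalTuple G P.1 i := by
    intro i j
    by_contra hne
    let M : MvPolynomial (Fin (n + 1)) Qbar := F i * G j - F j * G i
    have hM : M.IsHomogeneous (d + e) := ((hF i).mul (hG j)).sub ((hF j).mul (hG i))
    have hMeval : ∀ Q : ProjSpace n, MvPolynomial.eval Q.coords M
        = evalTuple F Q i * evalTuple G Q j - evalTuple F Q j * evalTuple G Q i := by
      intro Q
      simp [M, evalTuple]
    have hO : IsOpen ((Subtype.val ⁻¹' {Q : ProjSpace n | MvPolynomial.eval Q.coords M ≠ 0}
        : Set X) ∩ (V₁ ∩ V₂)) :=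
      ((isOpen_eval_ne_zero M hM).preimage continuous_subtype_val).inter (hV₁.inter hV₂)
    obtain ⟨Q, ⟨hQM, hQ₁, hQ₂⟩, hQW⟩ := hWd.inter_open_nonempty _ hO
      ⟨P, by simpa only [Set.mem_preimage, Set.mem_ofPred_eq, hMeval, sub_ne_zero] using hne,
        hP₁, hP₂⟩
    obtain ⟨hFQ, h₁⟩ := hgF ⟨Q, hWg hQW⟩ hQ₁
    obtain ⟨hGQ, h₂⟩ := hhG ⟨Q, hWh hQW⟩ hQ₂
    rw [hW Q hQW, h₂] at h₁
    obtain ⟨a, ha⟩ := (Projectivization.mk_eq_mk_iff' Qbar _ _ _ _).1 h₁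
    refine hQM ?_
    have hi := congrFun ha i
    have hj := congrFun ha j
    simp only [Pi.smul_apply, smul_eq_mul] at hi hj
    rw [hMeval]
    linear_combination (evalTuple F Q.1 j) * hi - (evalTuple F Q.1 i) * hj
  apply Subtype.ext
  rw [hgP, hhP]
  obtain ⟨j, hj⟩ := Function.ne_iff.1 hG0
  refine (Projectivization.mk_eq_mk_iff' Qbar _ _ _ _).2
    ⟨evalTuple F P.1 j / evalTuple G P.1 j, ?_⟩
  ext i
  have hj' : evalTuple G P.1 j ≠ 0 := hj
  simp only [Pi.smul_apply, smul_eq_mul]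
  rw [div_mul_eq_mul_div, div_eq_iff hj']
  exact (key i j).symm

namespace RationalMap

/-- The domain of definition: the points at which some representative is defined. -/
def domain (φ : RationalMap X Y) : Set X :=
  {P | ∃ g : PartialMap X Y, g.toRationalMap = φ ∧ P ∈ g.domain}

/-- The indeterminacy locus: the points at which no representative is defined. -/
def indeterminacyLocus (φ : RationalMap X Y) : Set X := φ.domainᶜ

/-- The value of a rational map at a point outside its indeterminacy locus. -/
noncomputable def value (φ : RationalMap X Y) (P : X) (hP : P ∉ φ.indeterminacyLocus) : Y :=
  (not_not.mp hP).choose.toFun ⟨P, (not_not.mp hP).choose_spec.2⟩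

/-- The value does not depend on the chosen representative. -/
theorem value_eq (φ : RationalMap X Y) (g : PartialMap X Y) (hg : g.toRationalMap = φ) (P : X)
    (hP : P ∉ φ.indeterminacyLocus) (hPg : P ∈ g.domain) : φ.value P hP = g.toFun ⟨P, hPg⟩ :=
  PartialMap.Equivalent.eq (Quotient.exact ((not_not.mp hP).choose_spec.1.trans hg.symm)) P _ hPg

/-- The set-theoretic image of `S` (of the points of `S` at which the map is defined). -/
def image (φ : RationalMap X Y) (S : Set X) : Set Y :=
  {Q | ∃ (P : X) (hP : P ∉ φ.indeterminacyLocus), P ∈ S ∧ φ.value P hP = Q}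

/-- A rational map is non-constant if its values are not all equal to one point. -/
def IsNonconstant (φ : RationalMap X Y) : Prop :=
  ¬ ∃ c : Y, ∀ (P : X) (hP : P ∉ φ.indeterminacyLocus), φ.value P hP = c

open Classical in
/-- A rational self-map `Φ` as a function on all points. On the indeterminacy locus, where it is
only ever used together with the hypothesis that this does not occur, it is the identity. -/
noncomputable def step (Φ : RationalMap X X) (P : X) : X :=
  if hP : P ∉ Φ.indeterminacyLocus then Φ.value P hP else P

/-- The `k`-th iterate `Φᵏ(x)`; meaningful if `Φⁱ(x)` avoids the indeterminacy locus of `Φ` for all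
`i < k`. -/
noncomputable def iterate (Φ : RationalMap X X) (k : ℕ) (x : X) : X := Φ.step^[k] x

/-- The set `X_Φ` of the points `x` such that every iterate `Φᵏ(x)` avoids the indeterminacy locus
of `Φ`. -/
def iterableSet (Φ : RationalMap X X) : Set X :=
  {x | ∀ k : ℕ, Φ.iterate k x ∉ Φ.indeterminacyLocus}

/-- The forward orbit `{Φᵏ(x) : k ≥ 0}`. -/
def orbit (Φ : RationalMap X X) (x : X) : Set X := Set.range fun k : ℕ => Φ.iterate k x

/-- The set `X_{Φ,f}` of the points `x ∈ X_Φ` whose forward orbit avoids the indeterminacy locus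
of `f`. -/
def iterableSetAvoiding (Φ : RationalMap X X) (f : RationalMap X Y) : Set X :=
  {x | x ∈ Φ.iterableSet ∧ f.indeterminacyLocus ∩ Φ.orbit x = ∅}

theorem iterate_notMem (Φ : RationalMap X X) (f : RationalMap X Y) {x : X}
    (hx : x ∈ Φ.iterableSetAvoiding f) (k : ℕ) : Φ.iterate k x ∉ f.indeterminacyLocus := fun h =>
  Set.eq_empty_iff_forall_notMem.mp hx.2 _ ⟨h, k, rfl⟩

/-- The sequence `f(Φᵏ(x))`, for `x ∈ X_{Φ,f}`. -/
noncomputable def valueAlongOrbit (Φ : RationalMap X X) (f : RationalMap X Y) {x : X}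
    (hx : x ∈ Φ.iterableSetAvoiding f) (k : ℕ) : Y :=
  f.value (Φ.iterate k x) (iterate_notMem Φ f hx k)

end RationalMap

open Classical in
/-- The absolute logarithmic Weil height on `ℙ¹(Q̄)`: the height of `[1 : 0]` is `0`, and the height
of `[a : b]` with `b ≠ 0` is the absolute logarithmic height of the algebraic number `a / b`. -/
noncomputable def weilHeight (P : ProjSpace 1) : ℝ :=
  if P.coords 1 = 0 then 0 else NumberField.absLogHeight₁ (P.coords 0 / P.coords 1)

open Classical in
/-- The height may be computed with any homogeneous coordinates. -/
theorem weilHeight_mk (a b : Qbar) (h : ![a, b] ≠ 0) :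
    weilHeight (ProjSpace.mk ![a, b] h) =
      if b = 0 then 0 else NumberField.absLogHeight₁ (a / b) := by
  obtain ⟨u, hu⟩ := Projectivization.exists_smul_eq_mk_rep Qbar ![a, b] h
  have h0 : (ProjSpace.mk ![a, b] h).coords 0 = u * a := (congrFun hu 0).symm
  have h1 : (ProjSpace.mk ![a, b] h).coords 1 = u * b := (congrFun hu 1).symm
  unfold weilHeight
  rw [h0, h1, mul_div_mul_left a b u.ne_zero]
  simp only [mul_eq_zero, u.ne_zero, false_or]

end HeightGap

/-!
The proof plays the Noetherian property of `X × X` against a quantitative Northcott theorem.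

Write `a n` for the value of `f` at the `n`-th point of the orbit. For each `i` the condition
`a (n + i) = a (m + i)` is Zariski closed in the pair of the `n`-th and the `m`-th point of the
orbit, because on the points of the orbit all the maps `f ∘ Φⁱ` are regular. By the Noetherian
property the conditions for `i < k`, for some `k`, imply all of them
(`exists_forall_proportional`). So `k` consecutive terms of the sequence `a` determine all later
ones, although the rational maps involved have no bounded degree. If two windows of length `k`
coincide, then `a` is eventually periodic and takes finitely many values; otherwise the first
`M + k` terms take at least `M ^ (1 / k)` values (`finite_range_or_le_card_image_pow`).

On the other hand all `a n` are rational over one number field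
(`exists_finiteDimensional_forall_smul_mem`), and the number of its points of height at most `h` is
at most exponential in `h` (`exists_card_le_exp_weilHeight`). If the limit superior were not
positive, the first `M + k` terms would have height at most `ε * log M` up to a constant, for every
`ε > 0`, hence would take only `O(M ^ δ)` values with `δ < 1 / k`.

Everything on the geometric side is expressed through sequences of homogeneous coordinates and the
relation `LocallyHomogeneous` between them, so that neighbourhoods are complements of hypersurfaces
and the Noetherian property is that of a polynomial ring.
-/

namespace HeightGap

/-! ### Locally homogeneous families and the Noetherian property -/

open MvPolynomial

section LocallyHomogeneous

variable {k ι σ τ ρ : Type*} [Field k]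

theorem eval_smul_of_isHomogeneous {F : MvPolynomial σ k} {d : ℕ} (hF : F.IsHomogeneous d) (c : k)
    (x : σ → k) : eval (c • x) F = c ^ d * eval x F := by
  rw [eval_eq, eval_eq, Finset.mul_sum]
  refine Finset.sum_congr rfl fun m hm => ?_
  have hd : ∑ i ∈ m.support, m i = d := by
    rw [← hF (mem_support_iff.1 hm), Finsupp.weight_apply]
    simp [Finsupp.sum]
  simp only [Pi.smul_apply, smul_eq_mul, mul_pow, Finset.prod_mul_distrib, Finset.prod_pow_eq_pow_sum,
    hd]
  ring

/-- A family of vectors `w` is a locally homogeneous function of a family of vectors `v` if near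
each index `n`, that is on a set of indices `m` on which some homogeneous polynomial in `v m` is
nonzero, `w m` is up to a nonzero factor given by homogeneous polynomials in `v m` of one common
degree. Regular maps in homogeneous coordinates are the case of interest; only the points of the
families matter, the ambient varieties do not appear. -/
def LocallyHomogeneous (v : ι → σ → k) (w : ι → τ → k) : Prop :=
  ∀ n, ∃ (p : MvPolynomial σ k) (e : ℕ), p.IsHomogeneous e ∧ eval (v n) p ≠ 0 ∧
    ∃ (d : ℕ) (F : τ → MvPolynomial σ k), (∀ i, (F i).IsHomogeneous d) ∧
      ∀ m, eval (v m) p ≠ 0 → ∃ c : k, c ≠ 0 ∧ w m = c • fun i => eval (v m) (F i)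

theorem LocallyHomogeneous.comp_index {κ : Type*} {v : ι → σ → k} {w : ι → τ → k}
    (h : LocallyHomogeneous v w) (s : κ → ι) : LocallyHomogeneous (v ∘ s) (w ∘ s) := by
  intro n
  obtain ⟨p, e, hp, hpn, d, F, hF, H⟩ := h (s n)
  exact ⟨p, e, hp, hpn, d, F, hF, fun m hm => H (s m) hm⟩

theorem LocallyHomogeneous.trans {u : ι → σ → k} {v : ι → τ → k} {w : ι → ρ → k}
    (h₁ : LocallyHomogeneous u v) (h₂ : LocallyHomogeneous v w) : LocallyHomogeneous u w := by
  intro n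
  obtain ⟨p, e, hp, hpn, d, F, hF, H⟩ := h₁ n
  obtain ⟨q, e', hq, hqn, d', G, hG, H'⟩ := h₂ n
  have hev : ∀ m (Q : MvPolynomial τ k),
      eval (u m) (aeval F Q) = eval (fun i => eval (u m) (F i)) Q := by
    intro m Q
    rw [aeval_def, ← eval₂_id, eval₂_eq_eval_map]
    induction Q using MvPolynomial.induction_on with
    | C a => simp
    | add p q hp hq => simp_all
    | mul_X p i hp => simp_all
  have hne : ∀ m, eval (u m) p ≠ 0 → ∀ {a : ℕ} {Q : MvPolynomial τ k}, Q.IsHomogeneous a →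
      ∃ c : k, c ≠ 0 ∧ eval (v m) Q = c ^ a * eval (u m) (aeval F Q) := by
    intro m hm a Q hQ
    obtain ⟨c, hc, hv⟩ := H m hm
    exact ⟨c, hc, by rw [hv, eval_smul_of_isHomogeneous hQ, hev]⟩
  refine ⟨p * aeval F q, e + d * e', hp.mul (hq.aeval F hF), ?_, d * d',
    fun i => aeval F (G i), fun i => (hG i).aeval F hF, ?_⟩
  · obtain ⟨c, hc, h⟩ := hne n hpn hq
    rw [map_mul]
    refine mul_ne_zero hpn fun h0 => hqn ?_
    rw [h, h0, mul_zero]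
  · intro m hm
    rw [map_mul] at hm
    obtain ⟨c, hc, hv⟩ := H m (left_ne_zero_of_mul hm)
    have hqm : eval (v m) q ≠ 0 := by
      rw [hv, eval_smul_of_isHomogeneous hq, ← hev]
      exact mul_ne_zero (pow_ne_zero _ hc) (right_ne_zero_of_mul hm)
    obtain ⟨c', hc', hw⟩ := H' m hqm
    refine ⟨c' * c ^ d', mul_ne_zero hc' (pow_ne_zero _ hc), ?_⟩
    rw [hw]
    ext i
    simp only [Pi.smul_apply, smul_eq_mul, hv, eval_smul_of_isHomogeneous (hG i), hev, mul_assoc]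

/-- If one step of a sequence `v` is locally homogeneous in `v`, then so are all later values of
any locally homogeneous function of `v`. -/
theorem LocallyHomogeneous.shift {v : ℕ → σ → k} {b : ℕ → τ → k}
    (hv : LocallyHomogeneous v fun n => v (n + 1)) (hb : LocallyHomogeneous v b) (i : ℕ) :
    LocallyHomogeneous v fun n => b (n + i) := by
  induction i with
  | zero => exact hb
  | succ i ih =>
    have := hv.trans (ih.comp_index fun n => n + 1)
    convert this using 3
    simp only [Function.comp_apply]
    congr 1
    omega

/-- The vanishing of all `2 × 2` minors of a pair of vectors: for nonzero vectors, equality of the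
points of projective space that they define. -/
def Proportional (x y : τ → k) : Prop := ∀ i j, x i * y j = x j * y i

/-- The Noetherian property of `𝔸^σ × 𝔸^σ`: countably many coincidence conditions
`w i n ∼ w i m` on pairs of indices, each of them closed in `(v n, v m)`, follow from finitely many
of them. -/
theorem exists_forall_proportional [Finite σ] {v : ι → σ → k} {w : ℕ → ι → τ → k}
    (hw : ∀ i, LocallyHomogeneous v (w i)) :
    ∃ N : ℕ, ∀ n m, (∀ i < N, Proportional (w i n) (w i m)) →
      ∀ i, Proportional (w i n) (w i m) := by
  classical
  let Q : Set (MvPolynomial (σ ⊕ σ) k) := {q | ∃ i, ∀ n m, Proportional (w i n) (w i m) →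
    eval (Sum.elim (v n) (v m)) q = 0}
  obtain ⟨T, hTQ, hT⟩ := (Submodule.fg_span_iff_fg_span_finset_subset Q).1
    (IsNoetherian.noetherian (Ideal.span Q))
  choose! a ha using fun q (hq : q ∈ Q) => hq
  refine ⟨T.sup a + 1, fun n m h i => ?_⟩
  by_contra hnp
  unfold Proportional at hnp
  push Not at hnp
  obtain ⟨j, l, hjl⟩ := hnp
  obtain ⟨p, e, hp, hpn, d, F, hF, H⟩ := hw i n
  obtain ⟨p', e', hp', hpm, d', F', hF', H'⟩ := hw i m
  have hev₁ : ∀ n m (q : MvPolynomial σ k),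
      eval (Sum.elim (v n) (v m)) (rename Sum.inl q) = eval (v n) q := fun n m q => by
    rw [eval_rename]; rfl
  have hev₂ : ∀ n m (q : MvPolynomial σ k),
      eval (Sum.elim (v n) (v m)) (rename Sum.inr q) = eval (v m) q := fun n m q => by
    rw [eval_rename]; rfl
  -- The minor that is nonzero at `(n, m)`, cut off to the neighbourhoods on which `F` and `F'`
  -- represent `w i`.
  let q : MvPolynomial (σ ⊕ σ) k := rename Sum.inl p * rename Sum.inr p' *
    (rename Sum.inl (F j) * rename Sum.inr (F' l) - rename Sum.inl (F l) * rename Sum.inr (F' j))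
  have hqQ : q ∈ Q := by
    refine ⟨i, fun n' m' hP => ?_⟩
    simp only [q, map_mul, map_sub, hev₁, hev₂]
    by_cases h₁ : eval (v n') p = 0
    · simp [h₁]
    by_cases h₂ : eval (v m') p' = 0
    · simp [h₂]
    obtain ⟨c, hc, hn⟩ := H n' h₁
    obtain ⟨c', hc', hm⟩ := H' m' h₂
    have := hP j l
    simp only [hn, hm, Pi.smul_apply, smul_eq_mul] at this
    refine mul_eq_zero_of_right _ (mul_left_cancel₀ (mul_ne_zero hc hc') ?_)
    linear_combination this
  have hker : Ideal.span Q ≤ RingHom.ker (eval (Sum.elim (v n) (v m))) := by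
    rw [show Ideal.span Q = Ideal.span (T : Set _) from hT, Ideal.span_le]
    exact fun t ht => ha t (hTQ ht) n m (h _ (Nat.lt_succ_of_le (Finset.le_sup ht)))
  have hq0 : eval (Sum.elim (v n) (v m)) q = 0 := hker (Ideal.subset_span hqQ)
  simp only [q, map_mul, map_sub, hev₁, hev₂] at hq0
  obtain ⟨c, hc, hn⟩ := H n hpn
  obtain ⟨c', hc', hm⟩ := H' m hpm
  have h0 := (mul_eq_zero.1 hq0).resolve_left (mul_ne_zero hpn hpm)
  refine hjl ?_
  simp only [hn, hm, Pi.smul_apply, smul_eq_mul]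
  linear_combination c * c' * h0

/-- Quasi-compactness: finitely many tuples of homogeneous polynomials, and so finitely many
coefficients, suffice for all indices. -/
theorem LocallyHomogeneous.exists_finset_coeff [Finite σ] [Finite τ] {v : ι → σ → k}
    {w : ι → τ → k} (h : LocallyHomogeneous v w) :
    ∃ S : Finset k, ∀ n, ∃ (d : ℕ) (F : τ → MvPolynomial σ k), (∀ i, (F i).IsHomogeneous d) ∧
      (∀ i m, (F i).coeff m ≠ 0 → (F i).coeff m ∈ S) ∧
      ∃ c : k, c ≠ 0 ∧ w n = c • fun i => eval (v n) (F i) := by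
  classical
  cases nonempty_fintype τ
  rcases isEmpty_or_nonempty ι with _ | _
  · exact ⟨∅, isEmptyElim⟩
  choose p e hp hpn d F hF H using h
  obtain ⟨T, hTQ, hT⟩ := (Submodule.fg_span_iff_fg_span_finset_subset (Set.range p)).1
    (IsNoetherian.noetherian (Ideal.span (Set.range p)))
  choose! a ha using fun q (hq : q ∈ Set.range p) => hq
  refine ⟨T.biUnion fun t => Finset.univ.biUnion fun i => (F (a t) i).support.image
    fun m => (F (a t) i).coeff m, fun n => ?_⟩
  obtain ⟨t, ht, htn⟩ : ∃ t ∈ T, eval (v n) t ≠ 0 := by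
    by_contra hcon
    push Not at hcon
    have hker : Ideal.span (Set.range p) ≤ RingHom.ker (eval (v n)) := by
      rw [show Ideal.span (Set.range p) = Ideal.span (T : Set _) from hT, Ideal.span_le]
      exact fun t ht => hcon t ht
    exact hpn n (hker (Ideal.subset_span ⟨n, rfl⟩))
  refine ⟨d (a t), F (a t), hF _, fun i m hm => ?_, H (a t) n (by rwa [ha t (hTQ ht)])⟩
  simp only [Finset.mem_biUnion, Finset.mem_image, Finset.mem_univ, true_and]
  exact ⟨t, ht, i, m, mem_support_iff.2 hm, rfl⟩

end LocallyHomogeneous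

/-- Homogeneous polynomials with coefficients in `K` map points of projective space that are
rational over `K` to such points. -/
theorem exists_smul_mem_of_eq_smul_eval {k L σ ρ : Type*} [Field k] [Field L] [Algebra k L]
    {K : IntermediateField k L} {x : σ → L} {y : ρ → L} {c : L} {d : ℕ}
    {F : ρ → MvPolynomial σ L} (hF : ∀ i, (F i).IsHomogeneous d)
    (hFK : ∀ i m, (F i).coeff m ≠ 0 → (F i).coeff m ∈ K) (hc : c ≠ 0)
    (hy : y = c • fun i => eval x (F i)) (hx : ∃ a : L, a ≠ 0 ∧ ∀ j, a * x j ∈ K) :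
    ∃ a : L, a ≠ 0 ∧ ∀ j, a * y j ∈ K := by
  obtain ⟨a, ha0, ha⟩ := hx
  subst hy
  refine ⟨a ^ d / c, div_ne_zero (pow_ne_zero _ ha0) hc, fun j => ?_⟩
  have : a ^ d / c * (c • fun i => eval x (F i)) j = eval (a • x) (F j) := by
    rw [eval_smul_of_isHomogeneous (hF j), Pi.smul_apply, smul_eq_mul]
    field_simp
  rw [this]
  exact eval_mem (s := K) (fun m hm => hFK j m (mem_support_iff.1 hm)) ha

/-- A common field of definition: the points of a sequence generated by a locally homogeneous
recurrence over `L`, and those of a locally homogeneous function of it, are all rational over one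
finite extension of `k`. -/
theorem exists_finiteDimensional_forall_smul_mem {k L σ τ : Type*} [Field k] [Field L]
    [Algebra k L] [Algebra.IsAlgebraic k L] [Finite σ] [Finite τ]
    {v : ℕ → σ → L} {b : ℕ → τ → L}
    (hv : LocallyHomogeneous v fun n => v (n + 1)) (hb : LocallyHomogeneous v b) :
    ∃ K : IntermediateField k L, FiniteDimensional k K ∧
      ∀ n, ∃ c : L, c ≠ 0 ∧ ∀ j, c * b n j ∈ K := by
  classical
  cases nonempty_fintype σ
  -- `K` is generated by the coefficients of the charts and the coordinates of the starting point.
  obtain ⟨S₁, h₁⟩ := hv.exists_finset_coeff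
  obtain ⟨S₂, h₂⟩ := hb.exists_finset_coeff
  let S : Finset L := S₁ ∪ S₂ ∪ Finset.univ.image (v 0)
  let K := IntermediateField.adjoin k (S : Set L)
  have hSK : ∀ s ∈ S, s ∈ K := fun s hs => IntermediateField.subset_adjoin k _ hs
  have hvK : ∀ n, ∃ a : L, a ≠ 0 ∧ ∀ j, a * v n j ∈ K := by
    intro n
    induction n with
    | zero =>
      refine ⟨1, one_ne_zero, fun j => ?_⟩
      rw [one_mul]
      exact hSK _ (by simp [S])
    | succ n ih =>
      obtain ⟨d, F, hF, hFS, c, hc, h⟩ := h₁ n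
      exact exists_smul_mem_of_eq_smul_eval hF (fun i m hm => hSK _ (by simp [S, hFS i m hm])) hc h ih
  refine ⟨K, IntermediateField.finiteDimensional_adjoin fun s _ =>
    (Algebra.IsAlgebraic.isAlgebraic s).isIntegral, fun n => ?_⟩
  obtain ⟨d, F, hF, hFS, c, hc, h⟩ := h₂ n
  exact exists_smul_mem_of_eq_smul_eval hF (fun i m hm => hSK _ (by simp [S, hFS i m hm])) hc h (hvK n)

end HeightGap

namespace HeightGap

/-! ### Counting algebraic numbers of bounded degree and height -/

open Polynomial NumberField Height IntermediateField

theorem infinitePlace_le_mulHeight₁ {K : Type*} [Field K] [NumberField K] (v : InfinitePlace K)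
    (x : K) : v x ≤ mulHeight₁ x := by
  classical
  have h1 : (1 : ℝ) ≤ ∏ᶠ w : FinitePlace K, max (w x) 1 := one_le_finprod fun _ => le_max_right _ _
  have h2 : max (v x) 1 ^ v.mult ≤ ∏ w : InfinitePlace K, max (w x) 1 ^ w.mult := by
    rw [← Finset.mul_prod_erase _ _ (Finset.mem_univ v)]
    exact le_mul_of_one_le_right (by positivity) (Finset.prod_induction _ (1 ≤ ·)
      (fun _ _ h h' => one_le_mul_of_one_le_of_one_le h h') le_rfl
      fun w _ => one_le_pow₀ (le_max_right _ _))
  rw [NumberField.mulHeight₁_eq]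
  calc v x ≤ max (v x) 1 := le_max_left _ _
    _ ≤ max (v x) 1 ^ v.mult := le_self_pow₀ (le_max_right _ _) v.mult_ne_zero
    _ ≤ _ := h2.trans (le_mul_of_one_le_right (zero_le_one.trans
      (h2.trans' (one_le_pow₀ (le_max_right _ _)))) h1)

/-- An algebraic number of bounded degree and height is, up to a bounded denominator `n`, a root of
an integer polynomial of bounded degree with bounded coefficients: the minimal polynomial of the
algebraic integer `n * x`, all conjugates of which are bounded. -/
theorem exists_polynomial_of_absLogHeight₁_le {L : Type*} [Field L] [CharZero L] {x : L}
    (hx : IsIntegral ℚ x) {D : ℕ} (hD : Module.finrank ℚ ℚ⟮x⟯ ≤ D) {h : ℝ} (h0 : 0 ≤ h)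
    (hh : absLogHeight₁ x ≤ h) :
    ∃ n : ℕ, n ≠ 0 ∧ (n : ℝ) ≤ Real.exp (D * h) ∧ ∃ P : ℤ[X], P ≠ 0 ∧ P.natDegree ≤ D ∧
      (∀ i, |(P.coeff i : ℝ)| ≤ (2 * Real.exp (D * h) ^ 2) ^ D) ∧ aeval (n * x) P = 0 := by
  have : FiniteDimensional ℚ ℚ⟮x⟯ := adjoin.finiteDimensional hx
  have : NumberField ℚ⟮x⟯ := {}
  set δ := Module.finrank ℚ ℚ⟮x⟯ with hδ
  have hδ0 : 0 < δ := Module.finrank_pos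
  set g := AdjoinSimple.gen ℚ x with hg
  set B := Real.exp (D * h) with hB
  have hB1 : 1 ≤ B := Real.one_le_exp (by positivity)
  have hH : mulHeight₁ g ≤ B := by
    have hlog : absLogHeight₁ x = (δ : ℝ)⁻¹ * Real.log (mulHeight₁ g) := by
      rw [absLogHeight₁, absMulHeight₁, dif_pos hx, Real.log_rpow (mulHeight₁_pos _)]
    rw [hlog, inv_mul_le_iff₀ (by exact_mod_cast hδ0)] at hh
    rw [hB, ← Real.log_le_iff_le_exp (mulHeight₁_pos _)]
    exact hh.trans (by gcongr)
  obtain ⟨n, hn0, hn, hint⟩ := exists_nat_le_mulHeight₁ g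
  have hnB : (n : ℝ) ≤ B := hn.trans hH
  have hmin := minpoly.isIntegrallyClosed_eq_field_fractions' ℚ hint
  refine ⟨n, hn0, hnB, minpoly ℤ ((n : ℚ⟮x⟯) * g), minpoly.ne_zero hint, ?_, fun i => ?_, ?_⟩
  · rw [← (minpoly.monic hint).natDegree_map (algebraMap ℤ ℚ), ← hmin]
    exact (minpoly.natDegree_le _).trans hD
  · have hφ : ∀ φ : ℚ⟮x⟯ →+* ℂ, ‖φ ((n : ℚ⟮x⟯) * g)‖ ≤ B ^ 2 := by
      intro φ
      have h1 : ‖φ g‖ ≤ B := (infinitePlace_le_mulHeight₁ (InfinitePlace.mk φ) g).trans hH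
      rw [map_mul, map_natCast, norm_mul, Complex.norm_natCast, sq]
      gcongr
    have hc := Embeddings.coeff_bdd_of_norm_le hφ i
    rw [hmin, coeff_map, ← hδ, max_eq_left (one_le_pow₀ hB1)] at hc
    have hch : ((δ.choose (δ / 2) : ℕ) : ℝ) ≤ 2 ^ D := by
      exact_mod_cast (Nat.choose_le_two_pow _ _).trans (Nat.pow_le_pow_right two_pos hD)
    have hc' : |((minpoly ℤ ((n : ℚ⟮x⟯) * g)).coeff i : ℝ)|
        ≤ (B ^ 2) ^ δ * (δ.choose (δ / 2) : ℕ) := by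
      simpa [Int.norm_eq_abs] using hc
    refine hc'.trans ?_
    rw [mul_pow, mul_comm (2 ^ D)]
    gcongr
    exact one_le_pow₀ hB1
  · have h1 : (n * x : L) = algebraMap ℚ⟮x⟯ L ((n : ℚ⟮x⟯) * g) := by
      rw [map_mul, map_natCast, hg, AdjoinSimple.algebraMap_gen]
    rw [h1, aeval_algebraMap_apply, minpoly.aeval, map_zero]

/-- A quantitative form of Northcott's theorem: the number of algebraic numbers of bounded degree
and of absolute logarithmic height at most `h` grows at most exponentially in `h`. -/
theorem exists_card_le_exp_height (L : Type*) [Field L] [CharZero L] [Algebra.IsAlgebraic ℚ L]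
    (D : ℕ) : ∃ C E : ℝ, 0 ≤ C ∧ 0 ≤ E ∧ ∀ (S : Finset L) (h : ℝ), 0 ≤ h →
      (∀ x ∈ S, Module.finrank ℚ ℚ⟮x⟯ ≤ D ∧ absLogHeight₁ x ≤ h) →
      (S.card : ℝ) ≤ C * Real.exp (E * h) := by
  classical
  refine ⟨(3 * 2 ^ D) ^ (D + 1) * D, D * (1 + 2 * D * (D + 1)), by positivity, by positivity,
    fun S h h0 hS => ?_⟩
  set B := Real.exp (D * h) with hB
  have hB1 : 1 ≤ B := Real.one_le_exp (by positivity)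
  set R := (2 * B ^ 2) ^ D with hR
  have hR1 : 1 ≤ R := one_le_pow₀ (by nlinarith)
  have hbox : ∀ i : Fin (D + 1), (⌊(fun _ : Fin (D + 1) => R) i⌋ -
      ⌈(fun _ : Fin (D + 1) => -R) i⌉ + 1).toNat = 2 * ⌊R⌋₊ + 1 := by
    intro i
    simp only [Int.ceil_neg]
    have := Int.natCast_floor_eq_floor (zero_le_one.trans hR1)
    omega
  have hcard := ncard_boxPoly D (fun _ => -R) fun _ => R
  rw [Finset.prod_congr rfl fun i _ => hbox i, Finset.prod_const, Finset.card_univ,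
    Fintype.card_fin] at hcard
  have hfin : (boxPoly D (fun _ => -R) fun _ => R).Finite := by
    refine Set.finite_of_ncard_ne_zero ?_
    rw [hcard]
    positivity
  have hsub : S ⊆ (Finset.Icc 1 ⌊B⌋₊ ×ˢ hfin.toFinset).biUnion fun q =>
      (q.2.aroots L).toFinset.image fun y => y / (q.1 : L) := by
    intro x hx
    obtain ⟨n, hn0, hn, P, hP0, hPD, hPR, hPx⟩ := exists_polynomial_of_absLogHeight₁_le
      (Algebra.IsAlgebraic.isAlgebraic x).isIntegral (hS x hx).1 h0 (hS x hx).2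
    simp only [Finset.mem_biUnion, Finset.mem_product, Finset.mem_Icc, Finset.mem_image,
      Set.Finite.mem_toFinset, Multiset.mem_toFinset, mem_aroots]
    refine ⟨(n, P), ⟨⟨Nat.one_le_iff_ne_zero.2 hn0, Nat.le_floor hn⟩, hPD,
      fun i => abs_le.1 (hPR i)⟩, n * x, ⟨hP0, hPx⟩, ?_⟩
    rw [mul_div_cancel_left₀]
    exact_mod_cast hn0
  have hle : S.card ≤ ⌊B⌋₊ * (2 * ⌊R⌋₊ + 1) ^ (D + 1) * D := by
    refine (Finset.card_le_card hsub).trans ((Finset.card_biUnion_le_card_mul _ _ D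
      fun q hq => Finset.card_image_le.trans ?_).trans_eq ?_)
    · rw [Finset.mem_product, Set.Finite.mem_toFinset] at hq
      exact (Multiset.toFinset_card_le _).trans ((card_roots' _).trans
        (natDegree_map_le.trans hq.2.1))
    · rw [Finset.card_product, Nat.card_Icc, Nat.add_sub_cancel, ← Set.ncard_eq_toFinset_card _ hfin,
        hcard]
  have hexp : Real.exp (D * (1 + 2 * D * (D + 1)) * h) = B * (B ^ (2 * D)) ^ (D + 1) := by
    rw [← pow_mul, ← pow_succ', hB, ← Real.exp_nat_mul]
    congr 1
    push_cast
    ring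
  calc (S.card : ℝ) ≤ ((⌊B⌋₊ * (2 * ⌊R⌋₊ + 1) ^ (D + 1) * D : ℕ) : ℝ) := by exact_mod_cast hle
    _ = (⌊B⌋₊ : ℝ) * (2 * (⌊R⌋₊ : ℝ) + 1) ^ (D + 1) * D := by push_cast; ring
    _ ≤ B * (3 * R) ^ (D + 1) * D := by
      gcongr
      · exact Nat.floor_le (by positivity)
      · have := Nat.floor_le (zero_le_one.trans hR1)
        linarith
    _ = _ := by
      rw [hexp, hR, mul_pow 2, ← pow_mul, ← mul_assoc, mul_pow _ (B ^ (2 * D))]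
      ring

end HeightGap

namespace HeightGap

/-! ### Growth of the number of values along an orbit -/

open IntermediateField

/-- If, for some `N`, `N` consecutive terms determine all later ones, then a sequence is eventually
periodic or its windows of length `N` are pairwise different, so that its first `M + N` terms take
at least `M ^ (1 / N)` values. -/
theorem finite_range_or_le_card_image_pow {α : Type*} [DecidableEq α] {a : ℕ → α} {N : ℕ}
    (h : ∀ n m, (∀ i < N, a (n + i) = a (m + i)) → ∀ i, a (n + i) = a (m + i)) :
    (Set.range a).Finite ∨ ∀ M, M ≤ ((Finset.range (M + N)).image a).card ^ N := by
  refine or_iff_not_imp_left.2 fun hinf M => ?_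
  have hper : ∀ n m, n < m → ¬ ∀ i, a (n + i) = a (m + i) := by
    intro n m hnm hp
    refine hinf (((Set.finite_Iio m).image a).subset ?_)
    rintro _ ⟨j, rfl⟩
    induction j using Nat.strong_induction_on with
    | _ j ih =>
      rcases lt_or_ge j m with hj | hj
      · exact ⟨j, hj, rfl⟩
      · have := hp (j - m)
        rw [Nat.add_sub_cancel' hj] at this
        rw [← this]
        exact ih _ (by omega)
  have hcard := Finset.card_le_card_of_injOn (s := Finset.range M)
    (t := Fintype.piFinset fun _ : Fin N => (Finset.range (M + N)).image a)
    (fun n (i : Fin N) => a (n + i)) (by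
      intro n hn
      simp only [Finset.coe_range, Set.mem_Iio] at hn
      simp only [Finset.mem_coe, Fintype.mem_piFinset, Finset.mem_image, Finset.mem_range]
      exact fun i => ⟨n + i, by omega, rfl⟩) (by
      intro n _ m _ hnm
      have hw : ∀ i < N, a (n + i) = a (m + i) := fun i hi => congrFun hnm ⟨i, hi⟩
      by_contra hne
      rcases lt_or_gt_of_ne hne with hlt | hlt
      · exact hper n m hlt (h n m hw)
      · exact hper m n hlt fun i => (h n m hw i).symm)
  simpa using hcard

/-- If `M + N` points have height at most `B + ε * log (M + N)` with `ε` small in terms of `E` and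
`N`, then the bound `1 + C * exp (E * h)` for the number of points of height at most `h` has
`N`-th power `O(M ^ (1 / 2))`, which is less than `M` for a large `M`. -/
theorem exists_nat_gt_one_add_mul_exp_pow (N : ℕ) {C E : ℝ} (hC : 0 ≤ C) (hE : 0 ≤ E) :
    ∃ ε : ℝ, 0 < ε ∧ ∀ B : ℝ, ∃ M : ℕ,
      (1 + C * Real.exp (E * (B + ε * Real.log (M + N : ℕ)))) ^ N < M := by
  refine ⟨1 / (2 * (N + 1) * (E + 1)), by positivity, fun B => ?_⟩
  set ε : ℝ := 1 / (2 * (N + 1) * (E + 1)) with hε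
  set A : ℝ := 1 + C * Real.exp (E * B) with hA
  set G : ℝ := (A ^ N) ^ 2 with hG
  have hA1 : 1 ≤ A := le_add_of_nonneg_right (by positivity)
  obtain ⟨M, hM⟩ := exists_nat_ge (2 * G + 1 + N)
  refine ⟨M, ?_⟩
  have hG0 : 0 ≤ G := by positivity
  have hN0 : (0 : ℝ) ≤ N := N.cast_nonneg
  have hM1 : (1 : ℝ) ≤ M := by linarith
  set t : ℝ := ((M + N : ℕ) : ℝ) with ht
  have htM : t = M + N := by rw [ht]; push_cast; ring
  have ht1 : 1 ≤ t := by linarith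
  have hexp : Real.exp (E * (B + ε * Real.log t)) = Real.exp (E * B) * t ^ (E * ε) := by
    rw [Real.rpow_def_of_pos (by linarith), ← Real.exp_add]
    congr 1
    ring
  have hδ : E * ε * N ≤ 1 / 2 := by
    rw [hε, mul_one_div, div_mul_eq_mul_div, div_le_div_iff₀ (by positivity) two_pos]
    nlinarith [mul_nonneg hE hN0]
  have ht2 : 1 ≤ t ^ (E * ε) := Real.one_le_rpow ht1 (by positivity)
  have hle : (1 + C * Real.exp (E * (B + ε * Real.log t))) ^ N ≤ A ^ N * t ^ (1 / 2 : ℝ) := by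
    calc (1 + C * Real.exp (E * (B + ε * Real.log t))) ^ N ≤ (A * t ^ (E * ε)) ^ N := by
          gcongr
          rw [hexp, hA]
          nlinarith
      _ = A ^ N * t ^ (E * ε * N) := by
          rw [mul_pow, ← Real.rpow_natCast (t ^ (E * ε)), ← Real.rpow_mul (by linarith)]
      _ ≤ _ := by gcongr
  refine hle.trans_lt (lt_of_pow_lt_pow_left₀ 2 (by positivity) ?_)
  rw [mul_pow, ← hG, ← Real.sqrt_eq_rpow, Real.sq_sqrt (by linarith), htM]
  nlinarith

/-! ### Rational maps in homogeneous coordinates -/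

theorem ProjSpace.mk_coords {n : ℕ} (P : ProjSpace n) :
    ProjSpace.mk P.coords (Projectivization.rep_nonzero P) = P :=
  Projectivization.mk_rep P

theorem ProjSpace.exists_coords_mk {n : ℕ} (w : Fin (n + 1) → Qbar) (hw : w ≠ 0) :
    ∃ c : Qbar, c ≠ 0 ∧ (ProjSpace.mk w hw).coords = c • w := by
  obtain ⟨u, hu⟩ := Projectivization.exists_smul_eq_mk_rep Qbar w hw
  exact ⟨u, u.ne_zero, hu.symm⟩

theorem ProjSpace.eq_iff_proportional {n : ℕ} {P Q : ProjSpace n} :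
    P = Q ↔ Proportional P.coords Q.coords := by
  refine ⟨fun h => h ▸ fun i j => mul_comm _ _, fun h => ?_⟩
  obtain ⟨j, hj⟩ := Function.ne_iff.1 (Projectivization.rep_nonzero Q)
  rw [← P.mk_coords, ← Q.mk_coords]
  refine (Projectivization.mk_eq_mk_iff' Qbar _ _ _ _).2 ⟨P.coords j / Q.coords j, ?_⟩
  ext i
  have hj' : Q.coords j ≠ 0 := hj
  simp only [Pi.smul_apply, smul_eq_mul]
  rw [div_mul_eq_mul_div, div_eq_iff hj']
  exact h j i

/-- For the `ℚ`-algebra structure that every field of characteristic zero carries, which on `Q̄` is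
not syntactically the one of the algebraic closure. -/
instance isAlgebraic_Qbar : Algebra.IsAlgebraic ℚ Qbar := by
  convert! AlgebraicClosure.isAlgebraic ℚ

/-- The number of points of `ℙ¹` that are rational over a given number field and of height at most
`h` grows at most exponentially in `h`. -/
theorem exists_card_le_exp_weilHeight (K : IntermediateField ℚ Qbar) [FiniteDimensional ℚ K] :
    ∃ C E : ℝ, 0 ≤ C ∧ 0 ≤ E ∧ ∀ (S : Finset (ProjSpace 1)) (h : ℝ), 0 ≤ h →
      (∀ P ∈ S, (∃ c : Qbar, c ≠ 0 ∧ ∀ j, c * P.coords j ∈ K) ∧ weilHeight P ≤ h) →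
      (S.card : ℝ) ≤ 1 + C * Real.exp (E * h) := by
  classical
  obtain ⟨C, E, hC, hE, H⟩ := exists_card_le_exp_height Qbar (Module.finrank ℚ K)
  refine ⟨C, E, hC, hE, fun S h h0 hS => ?_⟩
  have hinf : (S.filter fun P => P.coords 1 = 0).card ≤ 1 := by
    refine Finset.card_le_one.2 fun P hP Q hQ => ?_
    rw [Finset.mem_filter] at hP hQ
    rw [ProjSpace.eq_iff_proportional]
    intro i j
    fin_cases i <;> fin_cases j <;> simp [hP.2, hQ.2, mul_comm]
  let r : ProjSpace 1 → Qbar := fun P => P.coords 0 / P.coords 1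
  have hinj : Set.InjOn r (S.filter fun P => ¬ P.coords 1 = 0) := by
    intro P hP Q hQ hPQ
    simp only [Finset.coe_filter, Set.mem_ofPred_eq] at hP hQ
    have hPQ' := (div_eq_div_iff hP.2 hQ.2).1 hPQ
    rw [ProjSpace.eq_iff_proportional]
    intro i j
    fin_cases i <;> fin_cases j <;> simp only [Fin.zero_eta, Fin.mk_one, Fin.isValue]
    · linear_combination hPQ'
    · linear_combination -hPQ'
  have hfin := H ((S.filter fun P => ¬ P.coords 1 = 0).image r) h h0 (by
    intro y hy
    obtain ⟨P, hP, rfl⟩ := Finset.mem_image.1 hy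
    rw [Finset.mem_filter] at hP
    obtain ⟨⟨c, hc, hcK⟩, hw⟩ := hS P hP.1
    refine ⟨?_, ?_⟩
    · have hr : r P ∈ K := by
        rw [show r P = (c * P.coords 0) / (c * P.coords 1) from (mul_div_mul_left _ _ hc).symm]
        exact div_mem (hcK 0) (hcK 1)
      exact IntermediateField.finrank_le_of_le_right (adjoin_simple_le_iff.2 hr)
    · rwa [weilHeight, if_neg hP.2] at hw)
  rw [Finset.card_image_of_injOn hinj] at hfin
  rw [← Finset.card_filter_add_card_filter_not (s := S) fun P => P.coords 1 = 0, Nat.cast_add]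
  exact add_le_add (by exact_mod_cast hinf) hfin

/-- Near each point outside its indeterminacy locus, a rational map is given by homogeneous
polynomials of one common degree; the neighbourhood may be taken to be the complement of a
hypersurface. -/
theorem RationalMap.exists_chart {n m : ℕ} {X : Set (ProjSpace n)} {Y : Set (ProjSpace m)}
    (φ : RationalMap X Y) (P : X) (hP : P ∉ φ.indeterminacyLocus) :
    ∃ (p : MvPolynomial (Fin (n + 1)) Qbar) (e : ℕ), p.IsHomogeneous e ∧
      MvPolynomial.eval P.1.coords p ≠ 0 ∧
      ∃ (d : ℕ) (F : Fin (m + 1) → MvPolynomial (Fin (n + 1)) Qbar), (∀ i, (F i).IsHomogeneous d) ∧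
        ∀ (Q : X) (hQ : Q ∉ φ.indeterminacyLocus), MvPolynomial.eval Q.1.coords p ≠ 0 →
          ∃ c : Qbar, c ≠ 0 ∧ (φ.value Q hQ).1.coords =
            c • fun i => MvPolynomial.eval Q.1.coords (F i) := by
  obtain ⟨g, hg, hPg⟩ := not_not.1 hP
  obtain ⟨V, hV, hPV, d, F, hF, H⟩ := g.isRegular ⟨P, hPg⟩
  obtain ⟨O, hO, hOV⟩ := isOpen_induced_iff.1 (g.isOpen_domain.inter hV)
  obtain ⟨S, hS, hSO⟩ := (isClosed_iff_isAlgebraicSet _).1 hO.isClosed_compl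
  have hPO : P.1 ∉ zeroLocus S := by
    rw [hSO, Set.notMem_compl_iff]
    exact (Set.ext_iff.1 hOV P).2 ⟨hPg, hPV⟩
  obtain ⟨p, hpS, hp⟩ : ∃ p ∈ S, MvPolynomial.eval P.1.coords p ≠ 0 := by
    by_contra hcon
    push Not at hcon
    exact hPO hcon
  obtain ⟨e, he⟩ := hS p hpS
  refine ⟨p, e, he, hp, d, F, hF, fun Q hQ hpQ => ?_⟩
  have hQO : Q.1 ∈ O := by
    by_contra hcon
    rw [← Set.mem_compl_iff, ← hSO] at hcon
    exact hpQ (hcon p hpS)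
  obtain ⟨hQg, hQV⟩ := (Set.ext_iff.1 hOV Q).1 hQO
  obtain ⟨h, hval⟩ := H ⟨Q, hQg⟩ hQV
  rw [φ.value_eq g hg Q hQ hQg, hval]
  exact ProjSpace.exists_coords_mk _ h

/-- A rational map is locally homogeneous on any family of points outside its indeterminacy
locus. -/
theorem RationalMap.locallyHomogeneous {n m : ℕ} {X : Set (ProjSpace n)} {Y : Set (ProjSpace m)}
    (φ : RationalMap X Y) {ι : Type*} (y : ι → X) (hy : ∀ i, y i ∉ φ.indeterminacyLocus) :
    LocallyHomogeneous (fun i => (y i).1.coords) fun i => (φ.value (y i) (hy i)).1.coords := by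
  intro i
  obtain ⟨p, e, hp, hpi, d, F, hF, H⟩ := φ.exists_chart (y i) (hy i)
  exact ⟨p, e, hp, hpi, d, F, hF, fun j hj => H (y j) (hy j) hj⟩

theorem RationalMap.iterate_succ {n : ℕ} {X : Set (ProjSpace n)} (Φ : RationalMap X X) (x : X)
    (k : ℕ) (hk : Φ.iterate k x ∉ Φ.indeterminacyLocus) :
    Φ.iterate (k + 1) x = Φ.value (Φ.iterate k x) hk := by
  rw [iterate, Function.iterate_succ_apply']
  exact dif_pos hk

end HeightGap

open HeightGap in
theorem theorem1p2 {N : ℕ} (X : Set (HeightGap.ProjSpace N)) (hX : IsLocallyClosed X)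
    (Φ : HeightGap.RationalMap X X)
    (f : HeightGap.RationalMap X (Set.univ : Set (HeightGap.ProjSpace 1)))
    (hf : f.IsNonconstant) (x : X) (hx : x ∈ Φ.iterableSetAvoiding f) :
    (f.image (Φ.orbit x)).Finite ∨
      0 < Filter.limsup
        (fun n : ℕ =>
          ((HeightGap.weilHeight (Φ.valueAlongOrbit f hx n).1 / Real.log (n : ℝ) : ℝ) : EReal))
        Filter.atTop := by
  classical
  let a : ℕ → ProjSpace 1 := fun n => (Φ.valueAlongOrbit f hx n).1
  let v : ℕ → Fin (N + 1) → Qbar := fun n => (Φ.iterate n x).1.coords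
  let b : ℕ → Fin 2 → Qbar := fun n => (a n).coords
  have hv : LocallyHomogeneous v fun n => v (n + 1) := by
    have := Φ.locallyHomogeneous (fun n => Φ.iterate n x) hx.1
    simpa only [v, Φ.iterate_succ x _ (hx.1 _)] using this
  have hb : LocallyHomogeneous v b :=
    f.locallyHomogeneous (fun n => Φ.iterate n x) (Φ.iterate_notMem f hx)
  obtain ⟨k, hk⟩ := exists_forall_proportional fun i => hv.shift hb i
  have hdet : ∀ n m, (∀ i < k, a (n + i) = a (m + i)) → ∀ i, a (n + i) = a (m + i) :=
    fun n m h i => ProjSpace.eq_iff_proportional.2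
      (hk n m (fun i hi => ProjSpace.eq_iff_proportional.1 (h i hi)) i)
  rcases finite_range_or_le_card_image_pow hdet with hfin | hgrow
  · left
    refine Set.Finite.of_finite_image (f := Subtype.val) (hfin.subset ?_)
      Subtype.val_injective.injOn
    rintro _ ⟨_, ⟨_, hP, ⟨n, rfl⟩, rfl⟩, rfl⟩
    exact ⟨n, rfl⟩
  · right
    by_contra hlim
    obtain ⟨K, _, hK⟩ := exists_finiteDimensional_forall_smul_mem (k := ℚ) hv hb
    obtain ⟨C, E, hC, hE, hcount⟩ := exists_card_le_exp_weilHeight K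
    obtain ⟨ε, hε, hcontr⟩ := exists_nat_gt_one_add_mul_exp_pow k hC hE
    have hev := Filter.eventually_lt_of_limsup_lt
      ((not_lt.1 hlim).trans_lt (EReal.coe_pos.2 hε))
    obtain ⟨n₀, hn₀⟩ := Filter.eventually_atTop.1 hev
    -- The finitely many `n` outside the range of the asymptotic bound, and `n ≤ 1`, where
    -- `log n = 0` makes the quotient a junk value, only contribute to the constant `B`.
    let B : ℝ := ∑ n ∈ Finset.range (n₀ + 2), |weilHeight (a n)|
    have hB0 : 0 ≤ B := Finset.sum_nonneg fun _ _ => abs_nonneg _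
    have hheight : ∀ n T : ℕ, n < T → weilHeight (a n) ≤ B + ε * Real.log T := by
      intro n T hnT
      have hT : 0 ≤ Real.log T := Real.log_natCast_nonneg T
      rcases lt_or_ge n (n₀ + 2) with hn | hn
      · have := Finset.single_le_sum (f := fun n => |weilHeight (a n)|)
          (fun _ _ => abs_nonneg _) (Finset.mem_range.2 hn)
        have h' := le_abs_self (weilHeight (a n))
        have : |weilHeight (a n)| ≤ B := this
        nlinarith [mul_nonneg hε.le hT]
      · have hlog : 0 < Real.log n := Real.log_pos (by exact_mod_cast (by omega : 1 < n))
        have h1 := EReal.coe_lt_coe_iff.1 (hn₀ n (by omega))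
        rw [div_lt_iff₀ hlog] at h1
        have h2 : Real.log n ≤ Real.log T :=
          Real.log_le_log (by exact_mod_cast (by omega : 0 < n)) (by exact_mod_cast hnT.le)
        have : weilHeight (a n) < ε * Real.log n := h1
        nlinarith
    obtain ⟨M, hM⟩ := hcontr B
    refine absurd (hgrow M) (not_le.2 ?_)
    have hc := hcount ((Finset.range (M + k)).image a) (B + ε * Real.log (M + k : ℕ))
      (add_nonneg hB0 (mul_nonneg hε.le (Real.log_natCast_nonneg _))) (by
        intro P hP
        obtain ⟨n, hn, rfl⟩ := Finset.mem_image.1 hP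
        exact ⟨hK n, hheight n _ (Finset.mem_range.1 hn)⟩)
    have : ((((Finset.range (M + k)).image a).card ^ k : ℕ) : ℝ) < M := by
      rw [Nat.cast_pow]
      exact (pow_le_pow_left₀ (Nat.cast_nonneg _) hc k).trans_lt hM
    exact_mod_cast this
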